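/- Let $\Omega$ be a set and, for each $i\in\Omega$, let $\mathcal S_i\subseteq\mathbb R_+=[0,\infty)$ be an additive subsemigroup with $0\in\mathcal S_i$ which is commensurable: for all $s_1,\dots,s_N\in\mathcal S_i$ there are $s_0\in\mathcal S_i$ and $a_1,\dots,a_N\in\mathbb N=\{0,1,2,\dots\}$ with $s_k=a_ks_0$ for $k=1,\dots,N$. Let $\mathcal S=\sum_{i\in\Omega}\mathcal S_i$ be the semigroup of finitely supported functions $s$ on $\Omega$ with $s(j)\in\mathcal S_j$ for all $j$, and let $\mathcal S-\mathcal S\subseteq\mathbb R^\Omega$ be the group it generates. For $s\in\mathcal S-\mathcal S$ write $s_+=\max(s,0)$ and $s_-=\max(-s,0)$ (pointwise; both lie in $\mathcal S$). For $s\in\mathcal S$ and finite $u\subseteq\Omega$ let $s[u]\in\mathcal S$ be the function equal to $s$ on $u$ and to $0$ off $u$. Let $T=\{T_s\}_{s\in\mathcal S}$ be a semigroup of contractions on a complex Hilbert space $H$, i.e. $\|T_s\|\le 1$, $T_0=I$ and $T_{s+t}=T_sT_t$. A *regular unitary dilation* of $T$ is a semigroup of unitaries $U=\{U_s\}_{s\in\mathcal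 S}$ ($U_0=I$, $U_{s+t}=U_sU_t$) on a Hilbert space $K\supseteq H$ such that $P_HU_{s_-}^*U_{s_+}|_H=T_{s_-}^*T_{s_+}$ for all $s\in\mathcal S-\mathcal S$; it is *minimal* if $K$ is the closed linear span of $\{U_{s_-}^*U_{s_+}h : s\in\mathcal S-\mathcal S,\ h\in H\}$. Then: 1. $T$ has a regular unitary dilation if and only if for every finite $v\subseteq\Omega$ and every $s\in\mathcal S$, $$\sum_{u\subseteq v}(-1)^{|u|}\,T_{s[u]}^*T_{s[u]}\ \ge 0 .$$ 2. If $T$ has a regular unitary dilation, then it has a minimal one, and this is unique up to unitary equivalence: if $(K,U)$ and $(K',U')$ are minimal regular unitary dilations of $T$, there is a unitary $W:K\to K'$ with $W|_H=\mathrm{id}_H$ and $WU_s=U'_sW$ for all $s\in\mathcal S$. 3. Let $\mathcal S$ carry a topology such that, for every $t\in\mathcal S$, $(s-t)_+\to0$ and $(s-t)_-\to0$ in $\mathcal S$ as $s\to t$ (for example the topology inherited from the product topology of $\mathbb R^\Omega$). If $T$ is weakly continuous, then every minimal regular unitary dilation of $T$ is strongly continuous. -/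

import Mathlib

open Filter Topology

noncomputable section

namespace RegularDilation

universe u v w

/-! ## Index semigroups -/

/-- A (unital) additive semigroup of reals is commensurable if any finitely many of its elements
are natural multiples of a single element of it. -/
def IsCommensurable (A : AddSubmonoid ℝ) : Prop :=
  ∀ (N : ℕ) (s : Fin N → A), ∃ (s₀ : A) (a : Fin N → ℕ), ∀ i, s i = a i • s₀

/-- The semigroup `∑ i, Si i`: the finitely supported functions `s` on `Ω` with `s j ∈ Si j`
for every `j`. -/
def sumSemigroup {Ω : Type u} (Si : Ω → AddSubmonoid ℝ) : AddSubmonoid (Ω → ℝ) where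
  carrier := {s | (Function.support s).Finite ∧ ∀ j, s j ∈ Si j}
  zero_mem' := ⟨by simp, fun j => (Si j).zero_mem⟩
  add_mem' := fun {a b} ha hb =>
    ⟨(ha.1.union hb.1).subset (Function.support_add a b), fun j => (Si j).add_mem (ha.2 j) (hb.2 j)⟩

/-- The subgroup `S - S` of `ℝ^Ω` generated by `S`. -/
def diffGroup {Ω : Type u} (S : AddSubmonoid (Ω → ℝ)) : AddSubgroup (Ω → ℝ) :=
  AddSubgroup.closure (S : Set (Ω → ℝ))

/-- `S` is closed under `s ↦ s₊` and `s ↦ s₋` on `S - S`; here `s⁺ = max (s, 0)` and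
`s⁻ = max (-s, 0)`, computed pointwise. -/
def IsPlusMinusClosed {Ω : Type u} (S : AddSubmonoid (Ω → ℝ)) : Prop :=
  ∀ s ∈ diffGroup S, s⁺ ∈ S ∧ s⁻ ∈ S

/-- `s₊` as an element of `S`, for `s ∈ S - S`. -/
def plusPart {Ω : Type u} {S : AddSubmonoid (Ω → ℝ)} (hS : IsPlusMinusClosed S)
    (s : diffGroup S) : S := ⟨(s : Ω → ℝ)⁺, (hS s s.2).1⟩

/-- `s₋` as an element of `S`, for `s ∈ S - S`. -/
def minusPart {Ω : Type u} {S : AddSubmonoid (Ω → ℝ)} (hS : IsPlusMinusClosed S)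
    (s : diffGroup S) : S := ⟨(s : Ω → ℝ)⁻, (hS s s.2).2⟩

/-- The difference `s - t ∈ S - S` of two elements of `S`. -/
def diff {Ω : Type u} {S : AddSubmonoid (Ω → ℝ)} (s t : S) : diffGroup S :=
  ⟨(s : Ω → ℝ) - t, (diffGroup S).sub_mem (AddSubgroup.subset_closure s.2)
    (AddSubgroup.subset_closure t.2)⟩

theorem mem_diffGroup_iff {Ω : Type u} (S : AddSubmonoid (Ω → ℝ)) (s : Ω → ℝ) :
    s ∈ diffGroup S ↔ ∃ p ∈ S, ∃ q ∈ S, s = p - q := by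
  constructor
  · intro hs
    refine AddSubgroup.closure_induction (p := fun x _ => ∃ p ∈ S, ∃ q ∈ S, x = p - q)
      ?_ ?_ ?_ ?_ hs
    · exact fun x hx => ⟨x, hx, 0, S.zero_mem, by simp⟩
    · exact ⟨0, S.zero_mem, 0, S.zero_mem, by simp⟩
    · rintro x y _ _ ⟨p, hp, q, hq, rfl⟩ ⟨p', hp', q', hq', rfl⟩
      exact ⟨p + p', S.add_mem hp hp', q + q', S.add_mem hq hq', by abel⟩
    · rintro x _ ⟨p, hp, q, hq, rfl⟩
      exact ⟨q, hq, p, hp, by abel⟩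
  · rintro ⟨p, hp, q, hq, rfl⟩
    exact (diffGroup S).sub_mem (AddSubgroup.subset_closure hp) (AddSubgroup.subset_closure hq)

theorem posPart_sub_mem {A : AddSubmonoid ℝ} (hpos : ∀ x ∈ A, 0 ≤ x) (hA : IsCommensurable A)
    {x y : ℝ} (hx : x ∈ A) (hy : y ∈ A) : (x - y)⁺ ∈ A := by
  obtain ⟨s₀, a, ha⟩ := hA 2 ![⟨x, hx⟩, ⟨y, hy⟩]
  have h0 : x = a 0 • (s₀ : ℝ) := by simpa using congrArg (Subtype.val) (ha 0)
  have h1 : y = a 1 • (s₀ : ℝ) := by simpa using congrArg (Subtype.val) (ha 1)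
  have hs : (0 : ℝ) ≤ s₀ := hpos _ s₀.2
  rw [posPart_def]
  rcases le_total (a 0) (a 1) with h | h
  · have : x - y ≤ 0 := by
      rw [h0, h1, sub_nonpos]; exact nsmul_le_nsmul_left hs h
    rw [sup_of_le_right this]; exact A.zero_mem
  · have h2 : x - y = (a 0 - a 1) • (s₀ : ℝ) := by
      rw [h0, h1, sub_nsmul _ h, sub_eq_add_neg]
    have : 0 ≤ x - y := by rw [h2]; exact nsmul_nonneg hs _
    rw [sup_of_le_left this, h2]; exact A.nsmul_mem s₀.2 _

/-- A sum of commensurable unital subsemigroups of `ℝ₊` is closed under `s ↦ s₊, s₋`. -/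
theorem isPlusMinusClosed_sumSemigroup {Ω : Type u} (Si : Ω → AddSubmonoid ℝ)
    (hpos : ∀ i, ∀ x ∈ Si i, 0 ≤ x) (hcomm : ∀ i, IsCommensurable (Si i)) :
    IsPlusMinusClosed (sumSemigroup Si) := by
  have key : ∀ p ∈ sumSemigroup Si, ∀ q ∈ sumSemigroup Si, (p - q)⁺ ∈ sumSemigroup Si := by
    intro p hp q hq
    refine ⟨(hp.1.union hq.1).subset ?_, fun j => ?_⟩
    · intro j hj
      by_contra hc
      simp only [Set.mem_union, Function.mem_support, not_or, not_not] at hc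
      exact hj (by simp [hc.1, hc.2])
    · simpa using posPart_sub_mem (hpos j) (hcomm j) (hp.2 j) (hq.2 j)
  intro s hs
  obtain ⟨p, hp, q, hq, rfl⟩ := (mem_diffGroup_iff _ _).1 hs
  refine ⟨key p hp q hq, ?_⟩
  have : (p - q)⁻ = (q - p)⁺ := by rw [← posPart_neg, neg_sub]
  rw [this]; exact key q hq p hp

/-- `s[u]`: the function that agrees with `s` on `u` and vanishes elsewhere. -/
def restrict {Ω : Type u} {Si : Ω → AddSubmonoid ℝ} (s : sumSemigroup Si) (u : Finset Ω) :
    sumSemigroup Si :=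
  ⟨Set.indicator (u : Set Ω) (s : Ω → ℝ),
    s.2.1.subset (by rw [Set.support_indicator]; exact Set.inter_subset_right), fun j => by
      by_cases h : j ∈ (u : Set Ω)
      · rw [Set.indicator_of_mem h]; exact s.2.2 j
      · rw [Set.indicator_of_notMem h]; exact (Si j).zero_mem⟩

/-! ## Operator semigroups -/

section Semigroups

variable {Ω : Type u} {S : AddSubmonoid (Ω → ℝ)}
variable {H : Type v} [NormedAddCommGroup H] [InnerProductSpace ℂ H] [CompleteSpace H]

/-- A semigroup of contractions over `S`. -/
structure IsContractiveSemigroup (T : S → H →L[ℂ] H) : Prop where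
  map_zero : T 0 = ContinuousLinearMap.id ℂ H
  map_add : ∀ s t, T (s + t) = T s ∘L T t
  norm_le_one : ∀ s, ‖T s‖ ≤ 1

/-- A semigroup of unitaries over `S`. -/
structure IsUnitarySemigroup (U : S → H →L[ℂ] H) : Prop where
  map_zero : U 0 = ContinuousLinearMap.id ℂ H
  map_add : ∀ s t, U (s + t) = U s ∘L U t
  mem_unitary : ∀ s, U s ∈ unitary (H →L[ℂ] H)

/-- The operator `T_{s₋}^* T_{s₊}`, for `s ∈ S - S`. -/
def extend (hS : IsPlusMinusClosed S) (T : S → H →L[ℂ] H) (s : diffGroup S) : H →L[ℂ] H :=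
  (ContinuousLinearMap.adjoint (T (minusPart hS s))) ∘L T (plusPart hS s)

/-- Weak continuity of a family of operators, for a given topology on the index set. -/
def IsWeaklyContinuous (τ : TopologicalSpace S) (T : S → H →L[ℂ] H) : Prop :=
  ∀ x y : H, Continuous[τ, inferInstance] fun s => inner ℂ x (T s y)

/-- Strong continuity of a family of operators, for a given topology on the index set. -/
def IsStronglyContinuous (τ : TopologicalSpace S) (T : S → H →L[ℂ] H) : Prop :=
  ∀ x : H, Continuous[τ, inferInstance] fun s => T s x

/-- A topology on `S` is compatible with its structure if `(s - t)₊ → 0` and `(s - t)₋ → 0` in `S`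
as `s → t`, for every `t ∈ S`. -/
def IsCompatibleTopology (hS : IsPlusMinusClosed S) (τ : TopologicalSpace S) : Prop :=
  ∀ t : S, Tendsto (fun s : S => plusPart hS (diff s t)) (@nhds S τ t) (@nhds S τ 0) ∧
    Tendsto (fun s : S => minusPart hS (diff s t)) (@nhds S τ t) (@nhds S τ 0)

/-- The topology inherited from the product topology on `ℝ^Ω` is compatible. -/
theorem isCompatibleTopology_subtype (hS : IsPlusMinusClosed S) :
    IsCompatibleTopology hS (inferInstance : TopologicalSpace S) := by
  have hsub : ∀ t : S, Continuous fun s : S => (s : Ω → ℝ) - t := fun t => by fun_prop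
  intro t
  refine ⟨?_, ?_⟩
  · have hc : Continuous fun s : S => plusPart hS (diff s t) := by
      refine Continuous.subtype_mk ?_ _
      refine continuous_pi fun j => ?_
      have : Continuous fun s : S => max ((s : Ω → ℝ) j - (t : Ω → ℝ) j) 0 :=
        ((continuous_apply j).comp (hsub t)).max continuous_const
      simpa [diff, posPart_def] using this
    have h0 : plusPart hS (diff t t) = 0 := by
      apply Subtype.ext; simp [plusPart, diff]
    simpa [h0] using hc.tendsto t
  · have hc : Continuous fun s : S => minusPart hS (diff s t) := by
      refine Continuous.subtype_mk ?_ _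
      refine continuous_pi fun j => ?_
      have : Continuous fun s : S => max (-((s : Ω → ℝ) j - (t : Ω → ℝ) j)) 0 :=
        ((continuous_apply j).comp (hsub t)).neg.max continuous_const
      simpa [diff, negPart_def] using this
    have h0 : minusPart hS (diff t t) = 0 := by
      apply Subtype.ext; simp [minusPart, diff]
    simpa [h0] using hc.tendsto t

end Semigroups

/-! ## Regular unitary dilations -/

section Dilations

variable {Ω : Type u} {S : AddSubmonoid (Ω → ℝ)}
variable {H : Type v} [NormedAddCommGroup H] [InnerProductSpace ℂ H] [CompleteSpace H]
variable {K : Type w} [NormedAddCommGroup K] [InnerProductSpace ℂ K] [CompleteSpace K]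

/-- `U` is a regular unitary dilation of `T` on the Hilbert space `K`, which contains `H` through
the isometry `ι` (so that `ι^*` is the projection `P_H` and composition with `ι` is restriction
to `H`): `P_H U_{s₋}^* U_{s₊} |_H = T_{s₋}^* T_{s₊}` for all `s ∈ S - S`. -/
structure IsRegularUnitaryDilation (hS : IsPlusMinusClosed S) (T : S → H →L[ℂ] H)
    (ι : H →ₗᵢ[ℂ] K) (U : S → K →L[ℂ] K) : Prop where
  unitarySemigroup : IsUnitarySemigroup U
  dilation : ∀ s : diffGroup S,
    (ContinuousLinearMap.adjoint ι.toContinuousLinearMap) ∘L extend hS U s ∘L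
      ι.toContinuousLinearMap = extend hS T s

/-- A regular unitary dilation is minimal if `K` is the closed linear span of the subspaces
`U_s H`, `s ∈ S - S`, where `U_s = U_{s₋}^* U_{s₊}`. -/
structure IsMinimalRegularUnitaryDilation (hS : IsPlusMinusClosed S) (T : S → H →L[ℂ] H)
    (ι : H →ₗᵢ[ℂ] K) (U : S → K →L[ℂ] K) : Prop extends IsRegularUnitaryDilation hS T ι U where
  minimal : (Submodule.span ℂ
    {x : K | ∃ (s : diffGroup S) (h : H), x = extend hS U s (ι h)}).topologicalClosure = ⊤

end Dilations

/-- `T` has a regular unitary dilation. -/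
def HasRegularUnitaryDilation {Ω : Type u} {S : AddSubmonoid (Ω → ℝ)} (hS : IsPlusMinusClosed S)
    {H : Type v} [NormedAddCommGroup H] [InnerProductSpace ℂ H] [CompleteSpace H]
    (T : S → H →L[ℂ] H) : Prop :=
  ∃ (K : Type (max u v)) (_ : NormedAddCommGroup K) (_ : InnerProductSpace ℂ K)
    (_ : CompleteSpace K) (ι : H →ₗᵢ[ℂ] K) (U : S → K →L[ℂ] K),
    IsRegularUnitaryDilation hS T ι U

/-- `T` has a minimal regular unitary dilation. -/
def HasMinimalRegularUnitaryDilation {Ω : Type u} {S : AddSubmonoid (Ω → ℝ)}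
    (hS : IsPlusMinusClosed S)
    {H : Type v} [NormedAddCommGroup H] [InnerProductSpace ℂ H] [CompleteSpace H]
    (T : S → H →L[ℂ] H) : Prop :=
  ∃ (K : Type (max u v)) (_ : NormedAddCommGroup K) (_ : InnerProductSpace ℂ K)
    (_ : CompleteSpace K) (ι : H →ₗᵢ[ℂ] K) (U : S → K →L[ℂ] K),
    IsMinimalRegularUnitaryDilation hS T ι U

/-- For every finite `v ⊆ Ω` and every `s`, `∑_{u ⊆ v} (-1)^{|u|} T_{s[u]}^* T_{s[u]} ≥ 0`. -/
def AlternatingSumsNonneg {Ω : Type u} {Si : Ω → AddSubmonoid ℝ}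
    {H : Type v} [NormedAddCommGroup H] [InnerProductSpace ℂ H] [CompleteSpace H]
    (T : sumSemigroup Si → H →L[ℂ] H) : Prop :=
  ∀ (v : Finset Ω) (s : sumSemigroup Si),
    (∑ u ∈ v.powerset, (-1 : ℂ) ^ u.card •
      ((ContinuousLinearMap.adjoint (T (restrict s u))) ∘L T (restrict s u))).IsPositive

end RegularDilation

end

namespace RegularDilation

universe u v w w'

/-! ## Unitary extension of inner product preserving families -/

/-! Regular dilations correspond to positivity of the kernel `(s, t) ↦ T(t - s)` on `S - S`, where
`T(s) = T_{s₋}^* T_{s₊}`. Given positivity, the reproducing kernel space factors the kernel; it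
depends only on `t - s`, so translations of `S - S` act on that space by unitaries, which form the
minimal dilation. Conversely, the vectors `U_s h` have their Gram matrix prescribed by `T`, whence
uniqueness. Sufficiency thus reduces to deriving positivity from the alternating sums. By
commensurability, finitely many points of `S - S` lie, up to a common translation, on a grid `n ↦
(n_j σ_j)_j`. There a Möbius-type identity (`sum_Iic_inner_alternatingSum`) writes the quadratic
form as `∑_k ⟨ψ_k, Δ_{supp k} ψ_k⟩`, with `Δ_v` the alternating sum over subsets of `v`
(`grid_kernel_nonneg`). For necessity, the alternating sum evaluated at `x` is the squared norm of
`∑_u (-1)^{|u|} U_{s[u]}^* T_{s[u]} x` in the dilation space. Continuity follows from an explicit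
formula for `‖U_s h - U_t h‖²` in terms of `T`, together with density. -/

theorem inner_linearCombination {ι : Type u} {K : Type w} [NormedAddCommGroup K]
    [InnerProductSpace ℂ K] (x : ι → K) (c d : ι →₀ ℂ) :
    inner ℂ (Finsupp.linearCombination ℂ x c) (Finsupp.linearCombination ℂ x d) =
      c.sum fun i a => d.sum fun j b => star a * (b * inner ℂ (x i) (x j)) := by
  rw [Finsupp.linearCombination_apply, Finsupp.linearCombination_apply, Finsupp.sum, Finsupp.sum,
    sum_inner]
  refine Finset.sum_congr rfl fun i _ => ?_
  rw [inner_sum]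
  refine Finset.sum_congr rfl fun j _ => ?_
  rw [inner_smul_left, inner_smul_right]
  rfl

/-- The norm of a finite combination depends only on the Gram matrix, so matching coefficients is
isometric between two dense subspaces. This yields both the intertwiner in the uniqueness claim and
the translation unitaries in the existence proof. -/
theorem exists_linearIsometryEquiv_of_inner_eq {ι : Type u}
    {K₁ : Type w} [NormedAddCommGroup K₁] [InnerProductSpace ℂ K₁] [CompleteSpace K₁]
    {K₂ : Type w'} [NormedAddCommGroup K₂] [InnerProductSpace ℂ K₂] [CompleteSpace K₂]
    (x : ι → K₁) (y : ι → K₂)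
    (hx : (Submodule.span ℂ (Set.range x)).topologicalClosure = ⊤)
    (hy : (Submodule.span ℂ (Set.range y)).topologicalClosure = ⊤)
    (h : ∀ i j, inner ℂ (x i) (x j) = inner ℂ (y i) (y j)) :
    ∃ W : K₁ ≃ₗᵢ[ℂ] K₂, ∀ i, W (x i) = y i := by
  have hx' : DenseRange (Finsupp.linearCombination ℂ x) := by
    rw [DenseRange, ← LinearMap.coe_range, Finsupp.range_linearCombination]
    exact Submodule.dense_iff_topologicalClosure_eq_top.2 hx
  have hy' : DenseRange (Finsupp.linearCombination ℂ y) := by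
    rw [DenseRange, ← LinearMap.coe_range, Finsupp.range_linearCombination]
    exact Submodule.dense_iff_topologicalClosure_eq_top.2 hy
  have hn : ∀ c, ‖Finsupp.linearCombination ℂ y (LinearEquiv.refl ℂ (ι →₀ ℂ) c)‖ =
      ‖Finsupp.linearCombination ℂ x c‖ := by
    intro c
    rw [LinearEquiv.refl_apply, ← sq_eq_sq₀ (norm_nonneg _) (norm_nonneg _),
      ← inner_self_eq_norm_sq (𝕜 := ℂ), ← inner_self_eq_norm_sq (𝕜 := ℂ),
      inner_linearCombination, inner_linearCombination]
    simp only [h]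
  refine ⟨(LinearEquiv.refl ℂ (ι →₀ ℂ)).extendOfIsometry (Finsupp.linearCombination ℂ x)
    (Finsupp.linearCombination ℂ y) hx' hy' hn, fun i => ?_⟩
  simpa using LinearEquiv.extendOfIsometry_eq (LinearEquiv.refl ℂ (ι →₀ ℂ))
    (Finsupp.linearCombination ℂ x) (Finsupp.linearCombination ℂ y) hx' hy' hn (Finsupp.single i 1)

theorem ext_of_span_dense {ι : Type u} {K₁ : Type w} [NormedAddCommGroup K₁]
    [InnerProductSpace ℂ K₁] {K₂ : Type w'} [NormedAddCommGroup K₂] [InnerProductSpace ℂ K₂]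
    {x : ι → K₁} (hx : (Submodule.span ℂ (Set.range x)).topologicalClosure = ⊤)
    {A B : K₁ →L[ℂ] K₂} (h : ∀ i, A (x i) = B (x i)) : A = B :=
  ContinuousLinearMap.ext_on (Submodule.dense_iff_topologicalClosure_eq_top.2 hx)
    (by rintro _ ⟨i, rfl⟩; exact h i)

/-! ## Positivity of the kernel on a grid -/

section Grid

variable {Ω : Type u}

/-- The indicator of a finite set, as a finitely supported function. -/
noncomputable def unitVec (u : Finset Ω) : Ω →₀ ℕ := Finsupp.indicator u fun _ _ => 1

theorem unitVec_apply [DecidableEq Ω] (u : Finset Ω) (j : Ω) :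
    unitVec u j = if j ∈ u then 1 else 0 := by
  classical
  simp [unitVec, Finsupp.indicator_apply]

theorem unitVec_le_iff (u : Finset Ω) (k : Ω →₀ ℕ) : unitVec u ≤ k ↔ u ⊆ k.support := by
  classical
  simp only [Finsupp.le_def, unitVec_apply, Finset.subset_iff, Finsupp.mem_support_iff]
  refine forall_congr' fun j => ?_
  split_ifs with h
  · simp [h, Nat.one_le_iff_ne_zero]
  · simp [h]

/-- For fixed `u`, the map `k ↦ 1_u + (p - k)` is an involution of `{k | 1_u ≤ k ≤ p}`. Reindexing
by it makes `F q` independent of `u`, and the signs over subsets of `supp q` cancel unless `q = 0`.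
-/
theorem sum_Iic_sum_powerset_support [DecidableEq Ω] {M : Type v} [AddCommGroup M] [Module ℂ M]
    (p : Ω →₀ ℕ) (F : (Ω →₀ ℕ) → M) :
    ∑ k ∈ Finset.Iic p, ∑ u ∈ k.support.powerset,
      (-1 : ℂ) ^ u.card • F (unitVec u + (p - k)) = F 0 := by
  have h1 : ∑ k ∈ Finset.Iic p, ∑ u ∈ k.support.powerset,
      (-1 : ℂ) ^ u.card • F (unitVec u + (p - k)) =
      ∑ q ∈ Finset.Iic p, ∑ u ∈ q.support.powerset, (-1 : ℂ) ^ u.card • F q := by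
    rw [Finset.sum_sigma', Finset.sum_sigma']
    have key : ∀ (k : Ω →₀ ℕ) (u : Finset Ω), k ≤ p → unitVec u ≤ k →
        unitVec u + (p - (unitVec u + (p - k))) = k := by
      intro k u hk hu
      ext j
      have := hk j
      have := hu j
      simp only [Finsupp.coe_add, Finsupp.coe_tsub, Pi.add_apply, Pi.sub_apply]
      omega
    have mem : ∀ (k : Ω →₀ ℕ) (u : Finset Ω), k ≤ p → unitVec u ≤ k →
        unitVec u + (p - k) ≤ p := by
      intro k u hk hu j
      have := hk j
      have := hu j
      simp only [Finsupp.coe_add, Finsupp.coe_tsub, Pi.add_apply, Pi.sub_apply]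
      omega
    refine Finset.sum_nbij' (fun a => ⟨unitVec a.2 + (p - a.1), a.2⟩)
      (fun a => ⟨unitVec a.2 + (p - a.1), a.2⟩) ?_ ?_ ?_ ?_ ?_
    · rintro ⟨k, u⟩ h
      simp only [Finset.mem_sigma, Finset.mem_Iic, Finset.mem_powerset, ← unitVec_le_iff] at h ⊢
      exact ⟨mem k u h.1 h.2, le_self_add⟩
    · rintro ⟨k, u⟩ h
      simp only [Finset.mem_sigma, Finset.mem_Iic, Finset.mem_powerset, ← unitVec_le_iff] at h ⊢
      exact ⟨mem k u h.1 h.2, le_self_add⟩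
    · rintro ⟨k, u⟩ h
      simp only [Finset.mem_sigma, Finset.mem_Iic, Finset.mem_powerset, ← unitVec_le_iff] at h
      simp only [key k u h.1 h.2]
    · rintro ⟨k, u⟩ h
      simp only [Finset.mem_sigma, Finset.mem_Iic, Finset.mem_powerset, ← unitVec_le_iff] at h
      simp only [key k u h.1 h.2]
    · rintro ⟨k, u⟩ h
      rfl
  have h2 : ∀ q : Ω →₀ ℕ, ∑ u ∈ q.support.powerset, (-1 : ℂ) ^ u.card • F q =
      if q = 0 then F q else 0 := by
    intro q
    have := congrArg (Int.cast : ℤ → ℂ) (Finset.sum_powerset_neg_one_pow_card (x := q.support))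
    push_cast at this
    rw [← Finset.sum_smul, this]
    simp
  rw [h1, Finset.sum_congr rfl fun q _ => h2 q, Finset.sum_ite_eq']
  simp

variable {H : Type v} [NormedAddCommGroup H] [InnerProductSpace ℂ H] [CompleteSpace H]

/-- The alternating sum `∑_{u ⊆ v} (-1)^{|u|} A(1_u)^* A(1_u)`. -/
noncomputable def alternatingSum (A : (Ω →₀ ℕ) → H →L[ℂ] H) (v : Finset Ω) : H →L[ℂ] H :=
  ∑ u ∈ v.powerset, (-1 : ℂ) ^ u.card •
    (ContinuousLinearMap.adjoint (A (unitVec u)) ∘L A (unitVec u))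

theorem inner_alternatingSum (A : (Ω →₀ ℕ) → H →L[ℂ] H) (v : Finset Ω) (x y : H) :
    inner ℂ x (alternatingSum A v y) =
      ∑ u ∈ v.powerset, (-1 : ℂ) ^ u.card • inner ℂ (A (unitVec u) x) (A (unitVec u) y) := by
  simp only [alternatingSum, sum_apply, inner_sum,
    smul_apply, inner_smul_right, ContinuousLinearMap.comp_apply,
    ContinuousLinearMap.adjoint_inner_right, smul_eq_mul]

/-- For `k ≤ a ⊓ b`, both `a - k` and `b - k` split off the common part `a ⊓ b - k`, leaving `a - b`
and `b - a`. The preceding cancellation with `p = a ⊓ b` then keeps only the term where the common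
operator is `A 0 = I`. -/
theorem sum_Iic_inner_alternatingSum [DecidableEq Ω] (A : (Ω →₀ ℕ) → H →L[ℂ] H)
    (hA : ∀ m n, A (m + n) = A m ∘L A n) (h0 : A 0 = ContinuousLinearMap.id ℂ H)
    (a b : Ω →₀ ℕ) (x y : H) :
    ∑ k ∈ Finset.Iic (a ⊓ b), inner ℂ (A (a - k) x) (alternatingSum A k.support (A (b - k) y)) =
      inner ℂ (A (a - b) x) (A (b - a) y) := by
  have key := sum_Iic_sum_powerset_support (a ⊓ b)
    (fun q => inner ℂ (A q (A (a - b) x)) (A q (A (b - a) y)))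
  simp only [h0, ContinuousLinearMap.id_apply] at key
  rw [← key]
  refine Finset.sum_congr rfl fun k hk => ?_
  rw [Finset.mem_Iic] at hk
  rw [inner_alternatingSum]
  refine Finset.sum_congr rfl fun u _ => ?_
  have e1 : a - k = (a ⊓ b - k) + (a - b) := by
    ext j
    have := hk j
    simp only [Finsupp.coe_add, Finsupp.coe_tsub, Pi.add_apply, Pi.sub_apply,
      Finsupp.inf_apply] at this ⊢
    omega
  have e2 : b - k = (a ⊓ b - k) + (b - a) := by
    ext j
    have := hk j
    simp only [Finsupp.coe_add, Finsupp.coe_tsub, Pi.add_apply, Pi.sub_apply,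
      Finsupp.inf_apply] at this ⊢
    omega
  simp only [e1, e2, hA, ContinuousLinearMap.comp_apply]

theorem grid_kernel_nonneg {ι : Type w} (A : (Ω →₀ ℕ) → H →L[ℂ] H)
    (hA : ∀ m n, A (m + n) = A m ∘L A n) (h0 : A 0 = ContinuousLinearMap.id ℂ H)
    (hpos : ∀ v, (alternatingSum A v).IsPositive)
    (s : Finset ι) (n : ι → Ω →₀ ℕ) (h : ι → H) :
    0 ≤ (∑ i ∈ s, ∑ j ∈ s, inner ℂ (A (n i - n j) (h i)) (A (n j - n i) (h j))).re := by
  classical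
  set P : Ω →₀ ℕ := s.sup n
  -- The guard matters: with truncated subtraction `A (n i - k)` makes sense for every `k`, but only
  -- `k ≤ n i ⊓ n j` may contribute to the pair `(i, j)`.
  set ψ : (Ω →₀ ℕ) → H := fun k => ∑ i ∈ s, if k ≤ n i then A (n i - k) (h i) else 0
  have key : ∑ i ∈ s, ∑ j ∈ s, inner ℂ (A (n i - n j) (h i)) (A (n j - n i) (h j)) =
      ∑ k ∈ Finset.Iic P, inner ℂ (ψ k) (alternatingSum A k.support (ψ k)) := by
    have e : ∀ k, inner ℂ (ψ k) (alternatingSum A k.support (ψ k)) =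
        ∑ i ∈ s, ∑ j ∈ s, if k ≤ n i ⊓ n j then inner ℂ (A (n i - k) (h i))
          (alternatingSum A k.support (A (n j - k) (h j))) else 0 := by
      intro k
      simp only [ψ, map_sum, sum_inner]
      refine Finset.sum_congr rfl fun i _ => ?_
      rw [inner_sum]
      refine Finset.sum_congr rfl fun j _ => ?_
      by_cases h1 : k ≤ n i <;> by_cases h2 : k ≤ n j <;> simp [h1, h2]
    simp only [e]
    rw [Finset.sum_comm (s := Finset.Iic P)]
    refine Finset.sum_congr rfl fun i hi => ?_
    rw [Finset.sum_comm (s := Finset.Iic P)]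
    refine Finset.sum_congr rfl fun j hj => ?_
    have hP : n i ⊓ n j ≤ P := inf_le_left.trans (Finset.le_sup hi)
    rw [← sum_Iic_inner_alternatingSum A hA h0, ← Finset.sum_filter]
    refine Finset.sum_congr ?_ fun _ _ => rfl
    ext k
    simp only [Finset.mem_filter, Finset.mem_Iic]
    exact ⟨fun hk => ⟨hk.trans hP, hk⟩, And.right⟩
  rw [key, Complex.re_sum]
  exact Finset.sum_nonneg fun k _ => (hpos k.support).re_inner_nonneg_right (ψ k)

end Grid

/-! ## Finite subsets of `S - S` lie on grids -/

section GridPoints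

variable {Ω : Type u} {Si : Ω → AddSubmonoid ℝ}

/-- The point of `S` with coordinates `n j • σ j`. -/
noncomputable def gridPoint (σ : sumSemigroup Si) (n : Ω →₀ ℕ) : sumSemigroup Si :=
  ⟨fun j => n j • (σ : Ω → ℝ) j, σ.2.1.subset fun j hj hc => hj (by simp [hc]),
    fun j => (Si j).nsmul_mem (σ.2.2 j) _⟩

theorem gridPoint_zero (σ : sumSemigroup Si) : gridPoint σ 0 = 0 := by
  ext j
  simp [gridPoint]

theorem gridPoint_add (σ : sumSemigroup Si) (m n : Ω →₀ ℕ) :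
    gridPoint σ (m + n) = gridPoint σ m + gridPoint σ n := by
  ext j
  simp [gridPoint, add_mul]

theorem gridPoint_unitVec (σ : sumSemigroup Si) (u : Finset Ω) :
    gridPoint σ (unitVec u) = restrict σ u := by
  classical
  ext j
  by_cases h : j ∈ u <;> simp [gridPoint, restrict, unitVec_apply, h]

theorem posPart_nsmul_sub_nsmul {c : ℝ} (hc : 0 ≤ c) (m n : ℕ) :
    (m • c - n • c)⁺ = (m - n) • c := by
  rw [posPart_def]
  rcases le_total m n with h | h
  · rw [Nat.sub_eq_zero_of_le h, zero_nsmul, sup_eq_right, sub_nonpos]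
    exact nsmul_le_nsmul_left hc h
  · rw [sub_nsmul _ h, ← sub_eq_add_neg, sup_eq_left, sub_nonneg]
    exact nsmul_le_nsmul_left hc h

theorem plusPart_eq_gridPoint (hpos : ∀ i, ∀ x ∈ Si i, 0 ≤ x)
    (hS : IsPlusMinusClosed (sumSemigroup Si)) (σ : sumSemigroup Si) (m n : Ω →₀ ℕ)
    (x : diffGroup (sumSemigroup Si))
    (hx : ∀ j, (x : Ω → ℝ) j = m j • (σ : Ω → ℝ) j - n j • (σ : Ω → ℝ) j) :
    plusPart hS x = gridPoint σ (m - n) := by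
  ext j
  simp only [plusPart, gridPoint, Pi.posPart_apply, hx, Finsupp.coe_tsub, Pi.sub_apply]
  exact posPart_nsmul_sub_nsmul (hpos j _ (σ.2.2 j)) _ _

theorem minusPart_eq_gridPoint (hpos : ∀ i, ∀ x ∈ Si i, 0 ≤ x)
    (hS : IsPlusMinusClosed (sumSemigroup Si)) (σ : sumSemigroup Si) (m n : Ω →₀ ℕ)
    (x : diffGroup (sumSemigroup Si))
    (hx : ∀ j, (x : Ω → ℝ) j = m j • (σ : Ω → ℝ) j - n j • (σ : Ω → ℝ) j) :
    minusPart hS x = gridPoint σ (n - m) := by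
  ext j
  simp only [minusPart, gridPoint, Pi.negPart_apply, hx, Finsupp.coe_tsub, Pi.sub_apply]
  rw [← posPart_neg, neg_sub]
  exact posPart_nsmul_sub_nsmul (hpos j _ (σ.2.2 j)) _ _

theorem IsCommensurable.exists_finset {A : AddSubmonoid ℝ} (hA : IsCommensurable A)
    {ι : Type v} (F : Finset ι) (f : ι → ℝ) (hf : ∀ x, f x ∈ A) :
    ∃ s₀ ∈ A, ∃ a : ι → ℕ, ∀ x ∈ F, f x = a x • s₀ := by
  classical
  obtain ⟨s₀, a, h⟩ := hA F.card fun i => ⟨f (F.equivFin.symm i), hf _⟩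
  refine ⟨s₀, s₀.2, fun x => if hx : x ∈ F then a (F.equivFin ⟨x, hx⟩) else 0, fun x hx => ?_⟩
  have := congrArg Subtype.val (h (F.equivFin ⟨x, hx⟩))
  simpa [hx] using this

theorem exists_gridPoint_eq (hcomm : ∀ i, IsCommensurable (Si i)) {ι : Type v} (F : Finset ι)
    (f : ι → sumSemigroup Si) :
    ∃ (σ : sumSemigroup Si) (n : ι → Ω →₀ ℕ), ∀ x ∈ F, f x = gridPoint σ (n x) := by
  classical
  have hfin : (⋃ x ∈ F, Function.support (f x : Ω → ℝ)).Finite :=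
    F.finite_toSet.biUnion fun x _ => (f x).2.1
  choose σ hσ a ha using fun j => (hcomm j).exists_finset F (fun x => (f x : Ω → ℝ) j)
    fun x => (f x).2.2 j
  -- The common divisors are chosen coordinate by coordinate, so they and the multipliers are cut
  -- off outside the finite union of the supports.
  refine ⟨⟨fun j => if j ∈ hfin.toFinset then σ j else 0, hfin.subset fun j hj => ?_, fun j => ?_⟩,
    fun x => Finsupp.onFinset hfin.toFinset (fun j => if j ∈ hfin.toFinset then a j x else 0)
      fun j hj => ?_, fun x hx => ?_⟩
  · by_contra hc
    exact hj (if_neg (by simpa using hc))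
  · dsimp only
    split_ifs
    exacts [hσ j, (Si j).zero_mem]
  · by_contra hc
    exact hj (if_neg hc)
  · ext j
    by_cases hj : j ∈ hfin.toFinset
    · simp only [gridPoint, Finsupp.onFinset_apply, hj, if_true]
      exact ha j x hx
    · simp only [gridPoint, Finsupp.onFinset_apply, hj, if_false, smul_zero]
      by_contra hc
      exact hj (hfin.mem_toFinset.2 (Set.mem_biUnion hx hc))

/-- Only differences matter for the kernel, so the points may be translated into `S`. With `x = p x
- q x`, adding `∑ y ∈ F, q y` to `x` gives `p x + ∑_{y ≠ x} q y`, which lies in `S`. -/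
theorem exists_grid (hcomm : ∀ i, IsCommensurable (Si i))
    (F : Finset (diffGroup (sumSemigroup Si))) :
    ∃ (σ : sumSemigroup Si) (n : diffGroup (sumSemigroup Si) → Ω →₀ ℕ), ∀ x ∈ F, ∀ y ∈ F, ∀ j,
      ((x - y : diffGroup (sumSemigroup Si)) : Ω → ℝ) j =
        n x j • (σ : Ω → ℝ) j - n y j • (σ : Ω → ℝ) j := by
  classical
  choose p hp q hq hpq using
    fun x : diffGroup (sumSemigroup Si) => (mem_diffGroup_iff _ _).1 x.2
  obtain ⟨σ, n, h⟩ := exists_gridPoint_eq hcomm F fun x =>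
    ⟨p x, hp x⟩ + ∑ y ∈ F.erase x, ⟨q y, hq y⟩
  have h' : ∀ x ∈ F, (x : Ω → ℝ) = (gridPoint σ (n x) : Ω → ℝ) - ∑ y ∈ F, q y := by
    intro x hx
    rw [← h x hx, hpq x, ← Finset.add_sum_erase F q hx]
    push_cast
    abel
  refine ⟨σ, n, fun x hx y hy j => ?_⟩
  rw [AddSubgroup.coe_sub, h' x hx, h' y hy, sub_sub_sub_cancel_right]
  rfl

end GridPoints

/-! ## Positive definiteness of the dilation kernel -/

section Kernel

variable {Ω : Type u} {S : AddSubmonoid (Ω → ℝ)}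
variable {H : Type v} [NormedAddCommGroup H] [InnerProductSpace ℂ H] [CompleteSpace H]

/-- The operator-valued kernel `(s, t) ↦ T(t - s)` on `S - S`. -/
noncomputable def dilationKernel (hS : IsPlusMinusClosed S) (T : S → H →L[ℂ] H) :
    Matrix (diffGroup S) (diffGroup S) (H →L[ℂ] H) :=
  Matrix.of fun s t => extend hS T (t - s)

theorem plusPart_neg (hS : IsPlusMinusClosed S) (s : diffGroup S) :
    plusPart hS (-s) = minusPart hS s := by
  apply Subtype.ext
  simp [plusPart, minusPart]

theorem minusPart_neg (hS : IsPlusMinusClosed S) (s : diffGroup S) :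
    minusPart hS (-s) = plusPart hS s := by
  apply Subtype.ext
  simp [plusPart, minusPart]

theorem plusPart_sub_minusPart (hS : IsPlusMinusClosed S) (s : diffGroup S) :
    (plusPart hS s : Ω → ℝ) - minusPart hS s = s :=
  posPart_sub_negPart (s : Ω → ℝ)

theorem adjoint_extend (hS : IsPlusMinusClosed S) (T : S → H →L[ℂ] H) (s : diffGroup S) :
    ContinuousLinearMap.adjoint (extend hS T s) = extend hS T (-s) := by
  simp [extend, plusPart_neg, minusPart_neg, ContinuousLinearMap.adjoint_comp]

theorem inner_extend_left (hS : IsPlusMinusClosed S) (T : S → H →L[ℂ] H) (s : diffGroup S)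
    (x y : H) :
    inner ℂ (extend hS T s x) y = inner ℂ (T (plusPart hS s) x) (T (minusPart hS s) y) := by
  simp [extend, ContinuousLinearMap.adjoint_inner_left]

open scoped ComplexOrder in
-- On a grid, positive and negative parts of a difference are truncated differences of the
-- exponents. This puts the quadratic form into the shape of `grid_kernel_nonneg`, and the unit
-- cells of the grid are the `σ[u]` of the hypothesis.
theorem posSemidef_dilationKernel {Si : Ω → AddSubmonoid ℝ} (hpos : ∀ i, ∀ x ∈ Si i, 0 ≤ x)
    (hcomm : ∀ i, IsCommensurable (Si i)) (hS : IsPlusMinusClosed (sumSemigroup Si))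
    {T : sumSemigroup Si → H →L[ℂ] H} (hT : IsContractiveSemigroup T)
    (h : AlternatingSumsNonneg T) : (dilationKernel hS T).PosSemidef := by
  have tfae := (RKHS.posSemidef_tfae (K := dilationKernel hS T)).out 0 2
  refine tfae.2 ⟨?_, fun f => ?_⟩
  · ext1 s t
    rw [Matrix.conjTranspose_apply, ContinuousLinearMap.star_eq_adjoint]
    simp only [dilationKernel, Matrix.of_apply, adjoint_extend, neg_sub]
  · obtain ⟨σ, n, hn⟩ := exists_grid hcomm f.support
    have key := grid_kernel_nonneg (fun m => T (gridPoint σ m))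
      (fun m m' => by rw [gridPoint_add, hT.map_add]) (by rw [gridPoint_zero, hT.map_zero])
      (fun v => by simpa only [alternatingSum, gridPoint_unitVec] using h v σ) f.support n f
    rw [Finsupp.sum]
    simp only [Finsupp.sum]
    refine key.trans_eq (congrArg Complex.re ?_)
    refine Finset.sum_congr rfl fun x hx => Finset.sum_congr rfl fun y hy => ?_
    rw [dilationKernel, Matrix.of_apply, inner_extend_left,
      plusPart_eq_gridPoint hpos hS σ (n x) (n y) _ (hn x hx y hy),
      minusPart_eq_gridPoint hpos hS σ (n x) (n y) _ (hn x hx y hy)]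

end Kernel

/-! ## Unitary semigroups and their extension to `S - S` -/

section Unitary

variable {Ω : Type u} {S : AddSubmonoid (Ω → ℝ)}
variable {K : Type w} [NormedAddCommGroup K] [InnerProductSpace ℂ K] [CompleteSpace K]

theorem IsUnitarySemigroup.inner_map_map {U : S → K →L[ℂ] K} (hU : IsUnitarySemigroup U) (s : S)
    (x y : K) : inner ℂ (U s x) (U s y) = inner ℂ x y :=
  ContinuousLinearMap.inner_map_map_of_mem_unitary (hU.mem_unitary s) x y

theorem IsUnitarySemigroup.norm_map {U : S → K →L[ℂ] K} (hU : IsUnitarySemigroup U) (s : S)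
    (x : K) : ‖U s x‖ = ‖x‖ :=
  ContinuousLinearMap.norm_map_of_mem_unitary (hU.mem_unitary s) x

theorem IsUnitarySemigroup.apply_adjoint {U : S → K →L[ℂ] K} (hU : IsUnitarySemigroup U) (s : S)
    (x : K) : U s (ContinuousLinearMap.adjoint (U s) x) = x :=
  DFunLike.congr_fun (Unitary.mul_star_self_of_mem (hU.mem_unitary s)) x

theorem IsUnitarySemigroup.adjoint_apply {U : S → K →L[ℂ] K} (hU : IsUnitarySemigroup U) (s : S)
    (x : K) : ContinuousLinearMap.adjoint (U s) (U s x) = x :=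
  DFunLike.congr_fun (Unitary.star_mul_self_of_mem (hU.mem_unitary s)) x

theorem IsUnitarySemigroup.add_apply {U : S → K →L[ℂ] K} (hU : IsUnitarySemigroup U) (s t : S)
    (x : K) : U (s + t) x = U s (U t x) := by
  rw [hU.map_add]; rfl

theorem IsUnitarySemigroup.injective {U : S → K →L[ℂ] K} (hU : IsUnitarySemigroup U) (s : S) :
    Function.Injective (U s) := fun x y h => by
  rw [← hU.adjoint_apply s x, h, hU.adjoint_apply]

/-- If `s = p - q`, then `U_q U_s = U_p`. -/
theorem IsUnitarySemigroup.apply_extend (hS : IsPlusMinusClosed S) {U : S → K →L[ℂ] K}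
    (hU : IsUnitarySemigroup U) {s : diffGroup S} {p q : S} (h : (s : Ω → ℝ) = p - q) (x : K) :
    U q (extend hS U s x) = U p x := by
  have h1 : plusPart hS s + q = minusPart hS s + p := by
    apply Subtype.ext
    have := plusPart_sub_minusPart hS s
    rw [h, sub_eq_sub_iff_add_eq_add] at this
    rw [AddSubmonoid.coe_add, AddSubmonoid.coe_add, this, add_comm]
  apply hU.injective (minusPart hS s)
  rw [← hU.add_apply, ← hU.add_apply, ← h1, add_comm, hU.add_apply, add_comm, hU.add_apply]
  simp only [extend, ContinuousLinearMap.comp_apply]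
  rw [hU.apply_adjoint, ← hU.add_apply]

/-- Applying the unitary `U (s₋ + t₋)` to both vectors clears the adjoints. A common factor `U (t₊ +
s₋)` can then be cancelled. -/
theorem IsUnitarySemigroup.inner_extend_extend (hS : IsPlusMinusClosed S) {U : S → K →L[ℂ] K}
    (hU : IsUnitarySemigroup U) (s t : diffGroup S) (x y : K) :
    inner ℂ (extend hS U s x) (extend hS U t y) = inner ℂ (extend hS U (s - t) x) y := by
  have hs := plusPart_sub_minusPart hS s
  have ht := plusPart_sub_minusPart hS t
  rw [← hU.inner_map_map (minusPart hS s + minusPart hS t),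
    hU.apply_extend hS (p := plusPart hS s + minusPart hS t) (by
      rw [← hs]; push_cast; abel),
    hU.apply_extend hS (p := plusPart hS t + minusPart hS s) (by
      conv_lhs => rw [← ht]
      push_cast; abel),
    ← hU.apply_extend hS (s := s - t) (q := plusPart hS t + minusPart hS s) (by
      rw [AddSubgroup.coe_sub]
      conv_lhs => rw [← hs, ← ht]
      push_cast; abel), hU.inner_map_map]

/-- `U_t U_s = U_{t + s}` for `t ∈ S` and `s ∈ S - S`. -/
theorem IsUnitarySemigroup.apply_extend_eq (hS : IsPlusMinusClosed S) {U : S → K →L[ℂ] K}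
    (hU : IsUnitarySemigroup U) (t : S) (s : diffGroup S) (x : K) :
    U t (extend hS U s x) = extend hS U (diff t 0 + s) x := by
  apply hU.injective (minusPart hS s)
  rw [hU.apply_extend hS (s := diff t 0 + s) (p := t + plusPart hS s), ← hU.add_apply, add_comm,
    hU.add_apply, hU.apply_extend hS (p := plusPart hS s), hU.add_apply]
  · exact (plusPart_sub_minusPart hS s).symm
  · rw [AddSubgroup.coe_add, AddSubmonoid.coe_add, add_sub_assoc, plusPart_sub_minusPart]
    simp [diff]

theorem IsUnitarySemigroup.apply_extend_comm (hS : IsPlusMinusClosed S) {U : S → K →L[ℂ] K}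
    (hU : IsUnitarySemigroup U) (t : S) (s : diffGroup S) (x : K) :
    U t (extend hS U s x) = extend hS U s (U t x) := by
  apply hU.injective (minusPart hS s)
  have h := (plusPart_sub_minusPart hS s).symm
  rw [hU.apply_extend hS h, ← hU.add_apply, add_comm, hU.add_apply, hU.apply_extend hS h,
    ← hU.add_apply, ← hU.add_apply, add_comm]

end Unitary

/-! ## Regular unitary dilations -/

section Dilation

variable {Ω : Type u} {S : AddSubmonoid (Ω → ℝ)} {hS : IsPlusMinusClosed S}
variable {H : Type v} [NormedAddCommGroup H] [InnerProductSpace ℂ H] [CompleteSpace H]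
variable {K : Type w} [NormedAddCommGroup K] [InnerProductSpace ℂ K] [CompleteSpace K]
variable {K' : Type w'} [NormedAddCommGroup K'] [InnerProductSpace ℂ K'] [CompleteSpace K']
variable {T : S → H →L[ℂ] H}

theorem IsRegularUnitaryDilation.inner_extend {ι : H →ₗᵢ[ℂ] K} {U : S → K →L[ℂ] K}
    (h : IsRegularUnitaryDilation hS T ι U) (s : diffGroup S) (x y : H) :
    inner ℂ (extend hS U s (ι x)) (ι y) = inner ℂ (extend hS T s x) y := by
  rw [← h.dilation s]
  simp [ContinuousLinearMap.adjoint_inner_left]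

theorem IsRegularUnitaryDilation.inner_extend_extend {ι : H →ₗᵢ[ℂ] K} {U : S → K →L[ℂ] K}
    (h : IsRegularUnitaryDilation hS T ι U) (s t : diffGroup S) (x y : H) :
    inner ℂ (extend hS U s (ι x)) (extend hS U t (ι y)) = inner ℂ (extend hS T (s - t) x) y := by
  rw [h.unitarySemigroup.inner_extend_extend, h.inner_extend]

/-- Writing `U_s = U_t U_{s - t}` and cancelling `U_t` leaves an inner product known from the
dilation property. Necessity and continuity both rest on it. -/
theorem IsRegularUnitaryDilation.inner_map_map {ι : H →ₗᵢ[ℂ] K} {U : S → K →L[ℂ] K}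
    (h : IsRegularUnitaryDilation hS T ι U) (s t : S) (x y : H) :
    inner ℂ (U s (ι x)) (U t (ι y)) =
      inner ℂ (T (plusPart hS (diff s t)) x) (T (minusPart hS (diff s t)) y) := by
  rw [← inner_extend_left, ← h.inner_extend,
    ← h.unitarySemigroup.apply_extend hS (s := diff s t) (p := s) (q := t) rfl,
    h.unitarySemigroup.inner_map_map]

theorem IsMinimalRegularUnitaryDilation.span_eq_top {ι : H →ₗᵢ[ℂ] K} {U : S → K →L[ℂ] K}
    (h : IsMinimalRegularUnitaryDilation hS T ι U) :
    (Submodule.span ℂ (Set.range fun p : diffGroup S × H =>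
      extend hS U p.1 (ι p.2))).topologicalClosure = ⊤ := by
  rw [← h.minimal]
  congr 2
  ext x
  simp [eq_comm]

theorem extend_zero_apply {U : S → K →L[ℂ] K} (h0 : U 0 = ContinuousLinearMap.id ℂ K) (x : K) :
    extend hS U 0 x = x := by
  have h1 : plusPart hS (0 : diffGroup S) = 0 := by apply Subtype.ext; simp [plusPart]
  have h2 : minusPart hS (0 : diffGroup S) = 0 := by apply Subtype.ext; simp [minusPart]
  have h3 : ContinuousLinearMap.adjoint (ContinuousLinearMap.id ℂ K) =
    ContinuousLinearMap.id ℂ K := ContinuousLinearMap.adjoint_id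
  simp [extend, h1, h2, h0, h3]

/-- The spanning vectors `U_s h` have Gram matrix `⟨T(s - t) x, y⟩` in either space. The matching
unitary intertwines because `U_t` merely translates the index `s`. -/
theorem IsMinimalRegularUnitaryDilation.unique {ι : H →ₗᵢ[ℂ] K} {U : S → K →L[ℂ] K}
    {ι' : H →ₗᵢ[ℂ] K'} {U' : S → K' →L[ℂ] K'} (h : IsMinimalRegularUnitaryDilation hS T ι U)
    (h' : IsMinimalRegularUnitaryDilation hS T ι' U') :
    ∃ W : K ≃ₗᵢ[ℂ] K', (∀ x, W (ι x) = ι' x) ∧ ∀ s x, W (U s x) = U' s (W x) := by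
  obtain ⟨W, hW⟩ := exists_linearIsometryEquiv_of_inner_eq _ _ h.span_eq_top h'.span_eq_top
    fun p q => by simp only [h.inner_extend_extend, h'.inner_extend_extend]
  refine ⟨W, fun x => ?_, fun s => ?_⟩
  · simpa only [extend_zero_apply h.unitarySemigroup.map_zero,
      extend_zero_apply h'.unitarySemigroup.map_zero] using hW (0, x)
  · have : (W : K →L[ℂ] K') ∘L U s = U' s ∘L (W : K →L[ℂ] K') := by
      refine ext_of_span_dense h.span_eq_top fun p => ?_
      have h1 := hW p
      have h2 := hW (diff s 0 + p.1, p.2)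
      simp only at h1 h2
      change W (U s (extend hS U p.1 (ι p.2))) = U' s (W (extend hS U p.1 (ι p.2)))
      rw [h.unitarySemigroup.apply_extend_eq, h2, h1, h'.unitarySemigroup.apply_extend_eq]
    exact fun x => DFunLike.congr_fun this x

/-! ### Strong continuity -/

omit [CompleteSpace H] in
-- For contractions, weak convergence to `I` is strong: `‖T_s x - x‖² ≤ 2‖x‖² - 2 Re ⟨x, T_s x⟩`.
theorem IsContractiveSemigroup.tendsto_apply (hT : IsContractiveSemigroup T)
    {τ : TopologicalSpace S} (hc : IsWeaklyContinuous τ T) (x : H) :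
    Tendsto (fun s => T s x) (@nhds S τ 0) (𝓝 x) := by
  have h1 : Tendsto (fun s => 2 * ‖x‖ ^ 2 - 2 * (inner ℂ x (T s x)).re) (@nhds S τ 0) (𝓝 0) := by
    have h := (@Continuous.tendsto _ _ τ _ _ (hc x x) 0)
    have := ((Complex.continuous_re.tendsto _).comp h).const_mul 2 |>.const_sub (2 * ‖x‖ ^ 2)
    have e : (inner ℂ x x).re = ‖x‖ ^ 2 := inner_self_eq_norm_sq (𝕜 := ℂ) x
    rwa [hT.map_zero, ContinuousLinearMap.id_apply, e, sub_self] at this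
  rw [tendsto_iff_norm_sub_tendsto_zero]
  have h2 : Tendsto (fun s => ‖T s x - x‖ ^ 2) (@nhds S τ 0) (𝓝 0) := by
    refine squeeze_zero (fun s => sq_nonneg _) (fun s => ?_) h1
    have h3 : ‖T s x‖ ≤ ‖x‖ := by
      simpa using (T s).le_of_opNorm_le (hT.norm_le_one s) x
    have h4 : ‖T s x - x‖ ^ 2 = ‖T s x‖ ^ 2 - 2 * (inner ℂ (T s x) x).re + ‖x‖ ^ 2 :=
      norm_sub_sq (𝕜 := ℂ) _ _
    have h5 : (inner ℂ (T s x) x).re = (inner ℂ x (T s x)).re := inner_re_symm (𝕜 := ℂ) _ _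
    nlinarith [norm_nonneg (T s x), norm_nonneg x]
  simpa using h2.sqrt

/-- The squared distance equals `2‖x‖² - 2 Re ⟨T_{(s-t)₊} x, T_{(s-t)₋} x⟩`. Both arguments move
with `s`, which is why strong convergence at `0` is needed. -/
theorem IsRegularUnitaryDilation.tendsto_apply (hT : IsContractiveSemigroup T)
    {ι : H →ₗᵢ[ℂ] K} {U : S → K →L[ℂ] K} (h : IsRegularUnitaryDilation hS T ι U)
    {τ : TopologicalSpace S} (hτ : IsCompatibleTopology hS τ) (hc : IsWeaklyContinuous τ T)
    (t : S) (x : H) : Tendsto (fun s => U s (ι x)) (@nhds S τ t) (𝓝 (U t (ι x))) := by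
  have h1 : Tendsto (fun s => 2 * ‖x‖ ^ 2 - 2 * (inner ℂ (T (plusPart hS (diff s t)) x)
      (T (minusPart hS (diff s t)) x)).re) (@nhds S τ t) (𝓝 0) := by
    have h := ((hT.tendsto_apply hc x).comp (hτ t).1).inner (𝕜 := ℂ)
      ((hT.tendsto_apply hc x).comp (hτ t).2)
    have := ((Complex.continuous_re.tendsto _).comp h).const_mul 2 |>.const_sub (2 * ‖x‖ ^ 2)
    have e : (inner ℂ x x).re = ‖x‖ ^ 2 := inner_self_eq_norm_sq (𝕜 := ℂ) x
    rwa [e, sub_self] at this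
  rw [tendsto_iff_norm_sub_tendsto_zero]
  have h2 : Tendsto (fun s => ‖U s (ι x) - U t (ι x)‖ ^ 2) (@nhds S τ t) (𝓝 0) := by
    refine h1.congr fun s => ?_
    have h4 : ‖U s (ι x) - U t (ι x)‖ ^ 2 =
        ‖U s (ι x)‖ ^ 2 - 2 * (inner ℂ (U s (ι x)) (U t (ι x))).re + ‖U t (ι x)‖ ^ 2 :=
      norm_sub_sq (𝕜 := ℂ) _ _
    rw [h4, h.inner_map_map, h.unitarySemigroup.norm_map, h.unitarySemigroup.norm_map,
      ι.norm_map]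
    ring
  simpa using h2.sqrt

theorem IsMinimalRegularUnitaryDilation.isStronglyContinuous (hT : IsContractiveSemigroup T)
    {ι : H →ₗᵢ[ℂ] K} {U : S → K →L[ℂ] K} (h : IsMinimalRegularUnitaryDilation hS T ι U)
    {τ : TopologicalSpace S} (hτ : IsCompatibleTopology hS τ) (hc : IsWeaklyContinuous τ T) :
    IsStronglyContinuous τ U := by
  have hU := h.unitarySemigroup
  intro x
  let C : Submodule ℂ K :=
    { carrier := {y | Continuous[τ, inferInstance] fun s => U s y}
      zero_mem' := by
        simp only [Set.mem_ofPred_eq, map_zero]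
        exact @continuous_const _ _ τ _ _
      add_mem' := fun {a b} ha hb => by
        let := τ
        simp only [Set.mem_ofPred_eq, map_add] at ha hb ⊢
        exact ha.add hb
      smul_mem' := fun c a ha => by
        let := τ
        simp only [Set.mem_ofPred_eq, map_smul] at ha ⊢
        exact ha.const_smul c }
  -- Each `U r` is isometric, so approximation of `y` by `z` is uniform in `r`.
  have hC : IsClosed (C : Set K) := by
    refine isClosed_of_closure_subset fun y hy => ?_
    change Continuous[τ, inferInstance] fun s => U s y
    let := τ
    rw [continuous_iff_continuousAt]
    intro t
    rw [ContinuousAt, Metric.tendsto_nhds]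
    intro ε hε
    obtain ⟨z, hz, hyz⟩ := Metric.mem_closure_iff.1 hy (ε / 3) (by positivity)
    have hz' : Continuous fun s => U s z := hz
    filter_upwards [Metric.tendsto_nhds.1 (hz'.tendsto t) (ε / 3) (by positivity)] with s hs
    have e : ∀ r, dist (U r y) (U r z) = dist y z := fun r => by
      rw [dist_eq_norm, dist_eq_norm, ← map_sub, hU.norm_map]
    have h1 := dist_triangle4 (U s y) (U s z) (U t z) (U t y)
    rw [e, dist_comm (U t z), e] at h1
    linarith
  have hspan : Submodule.span ℂ (Set.range fun p : diffGroup S × H =>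
      extend hS U p.1 (ι p.2)) ≤ C := by
    rw [Submodule.span_le]
    rintro _ ⟨p, rfl⟩
    change Continuous[τ, inferInstance] fun s => U s (extend hS U p.1 (ι p.2))
    let := τ
    -- Commuting `U_s` past the fixed bounded operator reduces the claim to orbits of vectors of
    -- `H`.
    simp only [hU.apply_extend_comm]
    rw [continuous_iff_continuousAt]
    exact fun t => ((extend hS U p.1).continuous.tendsto _).comp
      (h.toIsRegularUnitaryDilation.tendsto_apply hT hτ hc t p.2)
  have := Submodule.topologicalClosure_minimal _ hspan hC
  rw [h.span_eq_top] at this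
  exact this (Submodule.mem_top (x := x))

end Dilation

/-! ## Existence of the minimal dilation -/

section Existence

variable {Ω : Type u} {S : AddSubmonoid (Ω → ℝ)} {hS : IsPlusMinusClosed S}
variable {H : Type v} [NormedAddCommGroup H] [InnerProductSpace ℂ H] [CompleteSpace H]
variable {T : S → H →L[ℂ] H}

theorem toContinuousLinearMap_mem_unitary {K : Type w} [NormedAddCommGroup K]
    [InnerProductSpace ℂ K] [CompleteSpace K] (e : K ≃ₗᵢ[ℂ] K) :
    (e : K →L[ℂ] K) ∈ unitary (K →L[ℂ] K) := by
  rw [← Unitary.coe_symm_linearIsometryEquiv_apply]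
  exact Subtype.prop _

/-- A family `V` of operators that factors the dilation kernel and has dense range gives rise to a
minimal regular unitary dilation. -/
theorem exists_isMinimalRegularUnitaryDilation_of_factorization (hT0 : T 0 =
    ContinuousLinearMap.id ℂ H) {K : Type w} [NormedAddCommGroup K]
    [InnerProductSpace ℂ K] [CompleteSpace K] (V : diffGroup S → H →L[ℂ] K)
    (hV : (Submodule.span ℂ (Set.range fun p : diffGroup S × H => V p.1 p.2)).topologicalClosure
      = ⊤)
    (hk : ∀ s t x y, inner ℂ (V s x) (V t y) = inner ℂ (extend hS T (s - t) x) y) :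
    ∃ (ι : H →ₗᵢ[ℂ] K) (U : S → K →L[ℂ] K), IsMinimalRegularUnitaryDilation hS T ι U := by
  -- The kernel is translation invariant, and translation by `g` permutes the spanning family, so it
  -- is implemented by a unitary.
  have hshift : ∀ g : diffGroup S, ∃ W : K ≃ₗᵢ[ℂ] K,
      ∀ p : diffGroup S × H, W (V p.1 p.2) = V (g + p.1) p.2 := by
    intro g
    refine exists_linearIsometryEquiv_of_inner_eq _ _ hV ?_ fun p q => ?_
    · rw [← hV]
      congr 2
      ext x
      constructor
      · rintro ⟨p, rfl⟩
        exact ⟨(g + p.1, p.2), rfl⟩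
      · rintro ⟨p, rfl⟩
        exact ⟨(-g + p.1, p.2), by simp⟩
    · rw [hk, hk, add_sub_add_left_eq_sub]
  choose W hW using hshift
  have hW' : ∀ g s x, W g (V s x) = V (g + s) x := fun g s x => hW g (s, x)
  have hWs : ∀ g s x, (W g).symm (V s x) = V (s - g) x := fun g s x => by
    rw [LinearIsometryEquiv.symm_apply_eq, hW', add_sub_cancel]
  let ι : H →ₗᵢ[ℂ] K :=
    { toLinearMap := (V 0 : H →ₗ[ℂ] K)
      norm_map' := fun x => by
        rw [← sq_eq_sq₀ (norm_nonneg _) (norm_nonneg _), ← inner_self_eq_norm_sq (𝕜 := ℂ),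
          ← inner_self_eq_norm_sq (𝕜 := ℂ)]
        change RCLike.re (inner ℂ (V 0 x) (V 0 x)) = _
        rw [hk, sub_zero, extend_zero_apply hT0] }
  have hι : ∀ x, ι x = V 0 x := fun x => rfl
  let U : S → K →L[ℂ] K := fun s => (W (diff s 0) : K →L[ℂ] K)
  have hUV : ∀ s t x, U s (V t x) = V (diff s 0 + t) x := fun s t x => hW' _ t x
  have hU : IsUnitarySemigroup U :=
    { map_zero := ext_of_span_dense hV fun p => by
        have : diff (0 : S) 0 = 0 := by apply Subtype.ext; simp [diff]
        rw [hUV, this, zero_add]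
        rfl
      map_add := fun s t => ext_of_span_dense hV fun p => by
        have : diff (s + t) 0 = diff s 0 + diff t 0 := by apply Subtype.ext; simp [diff]
        rw [ContinuousLinearMap.comp_apply, hUV, hUV, hUV, this, add_assoc]
      mem_unitary := fun s => toContinuousLinearMap_mem_unitary _ }
  -- Multiplying by `U_{s₋}` turns both sides into `V s₊ x`. The dilation identity and minimality
  -- then become the hypotheses on `V`.
  have hext : ∀ s x, extend hS U s (ι x) = V s x := by
    intro s x
    apply hU.injective (minusPart hS s)
    rw [hU.apply_extend hS (plusPart_sub_minusPart hS s).symm, hι, hUV, hUV, add_zero]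
    congr 2
    apply Subtype.ext
    have := plusPart_sub_minusPart hS s
    rw [AddSubgroup.coe_add, ← this]
    simp [diff]
  refine ⟨ι, U, ⟨⟨hU, fun s => ?_⟩, ?_⟩⟩
  · ext x
    refine ext_inner_right ℂ fun y => ?_
    have := hk s 0 x y
    rw [sub_zero] at this
    rw [← this, ← hext, ← hι]
    simp [ContinuousLinearMap.adjoint_inner_left]
  · rw [← hV]
    congr 2
    ext x
    simp [hext, eq_comm]

/-- In the reproducing kernel space the kernel functions factor the kernel and span densely. -/
theorem hasMinimalRegularUnitaryDilation_of_posSemidef (hT0 : T 0 = ContinuousLinearMap.id ℂ H)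
    (h : (dilationKernel hS T).PosSemidef) : HasMinimalRegularUnitaryDilation hS T := by
  have : Fact (dilationKernel hS T).PosSemidef := ⟨h⟩
  obtain ⟨ι, U, hU⟩ := exists_isMinimalRegularUnitaryDilation_of_factorization (hS := hS) hT0
    (K := RKHS.OfKernel (dilationKernel hS T))
    (fun s => RKHS.kerFun (RKHS.OfKernel (dilationKernel hS T)) s) (by
      rw [← RKHS.kerFun_dense (RKHS.OfKernel (dilationKernel hS T))]
      congr 2
      ext x
      simp) (fun s t x y => by
      rw [← RKHS.kernel_inner, RKHS.OfKernel.kernel_ofKernel]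
      rfl)
  exact ⟨_, _, _, inferInstance, ι, U, hU⟩

end Existence

/-! ## Necessity of the positivity condition -/

section Necessity

variable {Ω : Type u} {Si : Ω → AddSubmonoid ℝ}
variable {H : Type v} [NormedAddCommGroup H] [InnerProductSpace ℂ H] [CompleteSpace H]
variable {K : Type w} [NormedAddCommGroup K] [InnerProductSpace ℂ K] [CompleteSpace K]
variable {T : sumSemigroup Si → H →L[ℂ] H}

theorem plusPart_diff_restrict [DecidableEq Ω] (hpos : ∀ i, ∀ x ∈ Si i, 0 ≤ x)
    (hS : IsPlusMinusClosed (sumSemigroup Si)) (s : sumSemigroup Si) (u v : Finset Ω) :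
    plusPart hS (diff (restrict s u) (restrict s v)) = restrict s (u \ v) := by
  ext j
  have := hpos j _ (s.2.2 j)
  by_cases hu : j ∈ u <;> by_cases hv : j ∈ v <;>
    simp [plusPart, diff, restrict, hu, hv, this]

theorem minusPart_diff_restrict [DecidableEq Ω] (hpos : ∀ i, ∀ x ∈ Si i, 0 ≤ x)
    (hS : IsPlusMinusClosed (sumSemigroup Si)) (s : sumSemigroup Si) (u v : Finset Ω) :
    minusPart hS (diff (restrict s u) (restrict s v)) = restrict s (v \ u) := by
  ext j
  have := hpos j _ (s.2.2 j)
  by_cases hu : j ∈ u <;> by_cases hv : j ∈ v <;>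
    simp [minusPart, diff, restrict, hu, hv, this]

theorem restrict_sdiff_add_restrict [DecidableEq Ω] (s : sumSemigroup Si) (u v : Finset Ω) :
    restrict s (u \ v) + restrict s v = restrict s (u ∪ v) := by
  ext j
  by_cases hu : j ∈ u <;> by_cases hv : j ∈ v <;> simp [restrict, hu, hv]

/-- Toggling a fixed `i ∈ u` in `t` flips the sign and leaves `t ∪ u` unchanged. -/
theorem sum_powerset_neg_one_pow_union [DecidableEq Ω] (v u : Finset Ω) (hu : u ⊆ v)
    (hne : u.Nonempty) (f : Finset Ω → ℂ) :
    ∑ t ∈ v.powerset, (-1 : ℂ) ^ t.card * f (t ∪ u) = 0 := by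
  obtain ⟨i, hi⟩ := hne
  have hv : v = insert i (v.erase i) := (Finset.insert_erase (hu hi)).symm
  rw [hv, Finset.sum_powerset_insert (Finset.notMem_erase i v), ← Finset.sum_add_distrib]
  refine Finset.sum_eq_zero fun t ht => ?_
  have hit : i ∉ t := fun h => Finset.notMem_erase i v (Finset.mem_powerset.1 ht h)
  have : insert i t ∪ u = t ∪ u := by
    rw [Finset.insert_union, Finset.insert_eq_of_mem (Finset.mem_union_right _ hi)]
  rw [Finset.card_insert_of_notMem hit, this]
  ring

theorem IsRegularUnitaryDilation.alternatingSumsNonneg (hpos : ∀ i, ∀ x ∈ Si i, 0 ≤ x)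
    {hS : IsPlusMinusClosed (sumSemigroup Si)} (hT : IsContractiveSemigroup T)
    {ι : H →ₗᵢ[ℂ] K} {U : sumSemigroup Si → K →L[ℂ] K}
    (h : IsRegularUnitaryDilation hS T ι U) : AlternatingSumsNonneg T := by
  classical
  have hU := h.unitarySemigroup
  intro v s
  rw [ContinuousLinearMap.isPositive_iff_complex]
  intro x
  -- Chosen so that `⟨y t, y u⟩ = ‖T_{s[t ∪ u]} x‖²` depends only on the union.
  let y : Finset Ω → K := fun u => ContinuousLinearMap.adjoint (U (restrict s u))
    (ι (T (restrict s u) x))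
  have hy : ∀ t u, inner ℂ (y t) (y u) =
      inner ℂ (T (restrict s (t ∪ u)) x) (T (restrict s (t ∪ u)) x) := by
    intro t u
    rw [← hU.inner_map_map (restrict s t + restrict s u), hU.map_add]
    have e1 : (U (restrict s t) ∘L U (restrict s u)) (y t) =
        U (restrict s u) (ι (T (restrict s t) x)) := by
      rw [← hU.map_add, add_comm, hU.add_apply, hU.apply_adjoint]
    have e2 : (U (restrict s t) ∘L U (restrict s u)) (y u) =
        U (restrict s t) (ι (T (restrict s u) x)) := by
      rw [ContinuousLinearMap.comp_apply, hU.apply_adjoint]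
    rw [e1, e2, h.inner_map_map, plusPart_diff_restrict hpos, minusPart_diff_restrict hpos,
      ← ContinuousLinearMap.comp_apply, ← ContinuousLinearMap.comp_apply, ← hT.map_add,
      ← hT.map_add, restrict_sdiff_add_restrict, restrict_sdiff_add_restrict, Finset.union_comm]
  have key : inner ℂ ((∑ u ∈ v.powerset, (-1 : ℂ) ^ u.card •
      (ContinuousLinearMap.adjoint (T (restrict s u)) ∘L T (restrict s u))) x) x =
      inner ℂ (∑ u ∈ v.powerset, (-1 : ℂ) ^ u.card • y u)
        (∑ u ∈ v.powerset, (-1 : ℂ) ^ u.card • y u) := by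
    have hc : ∀ n : ℕ, (starRingEnd ℂ) ((-1 : ℂ) ^ n) = (-1) ^ n := fun n => by simp
    rw [inner_sum]
    -- In the double sum every nonempty `u` contributes zero by the toggling lemma; `u = ∅` gives
    -- the alternating sum.
    refine Eq.trans ?_ (Finset.sum_eq_single ∅ (fun u hu hne => ?_)
      fun hc => absurd (Finset.empty_mem_powerset v) hc).symm
    · simp only [sum_apply, smul_apply, sum_inner, inner_smul_left, inner_smul_right, hc, hy,
        ContinuousLinearMap.comp_apply, ContinuousLinearMap.adjoint_inner_left,
        Finset.union_empty, Finset.card_empty, pow_zero, one_mul]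
    · simp only [sum_inner, inner_smul_left, inner_smul_right, hc, hy]
      rw [sum_powerset_neg_one_pow_union v u (Finset.mem_powerset.1 hu)
        (Finset.nonempty_iff_ne_empty.2 hne) fun t =>
          inner ℂ (T (restrict s t) x) (T (restrict s t) x), mul_zero]
  rw [key]
  exact ⟨inner_self_ofReal_re _, inner_self_nonneg⟩

end Necessity

end RegularDilation

theorem mainTheorem2 {Ω : Type*} (Si : Ω → AddSubmonoid ℝ)
    (hpos : ∀ i, ∀ x ∈ Si i, 0 ≤ x) (hcomm : ∀ i, RegularDilation.IsCommensurable (Si i))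
    {H : Type*} [NormedAddCommGroup H] [InnerProductSpace ℂ H] [CompleteSpace H]
    (T : RegularDilation.sumSemigroup Si → H →L[ℂ] H)
    (hT : RegularDilation.IsContractiveSemigroup T) :
    let hS := RegularDilation.isPlusMinusClosed_sumSemigroup Si hpos hcomm
    -- existence
    (RegularDilation.HasRegularUnitaryDilation hS T ↔ RegularDilation.AlternatingSumsNonneg T) ∧
    -- if there is a regular unitary dilation, there is a minimal one
    (RegularDilation.HasRegularUnitaryDilation hS T →
      RegularDilation.HasMinimalRegularUnitaryDilation hS T) ∧
    -- uniqueness of the minimal one up to unitary equivalence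
    (∀ (K₁ : Type*) [NormedAddCommGroup K₁] [InnerProductSpace ℂ K₁] [CompleteSpace K₁]
      (K₂ : Type*) [NormedAddCommGroup K₂] [InnerProductSpace ℂ K₂] [CompleteSpace K₂]
      (ι₁ : H →ₗᵢ[ℂ] K₁) (U₁ : RegularDilation.sumSemigroup Si → K₁ →L[ℂ] K₁)
      (ι₂ : H →ₗᵢ[ℂ] K₂) (U₂ : RegularDilation.sumSemigroup Si → K₂ →L[ℂ] K₂),
      RegularDilation.IsMinimalRegularUnitaryDilation hS T ι₁ U₁ →
      RegularDilation.IsMinimalRegularUnitaryDilation hS T ι₂ U₂ →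
      ∃ W : K₁ ≃ₗᵢ[ℂ] K₂, (∀ h : H, W (ι₁ h) = ι₂ h) ∧ ∀ s x, W (U₁ s x) = U₂ s (W x)) ∧
    -- continuity
    (∀ τ : TopologicalSpace (RegularDilation.sumSemigroup Si),
      RegularDilation.IsCompatibleTopology hS τ →
      RegularDilation.IsWeaklyContinuous τ T →
      ∀ (K : Type*) [NormedAddCommGroup K] [InnerProductSpace ℂ K] [CompleteSpace K]
        (ι : H →ₗᵢ[ℂ] K) (U : RegularDilation.sumSemigroup Si → K →L[ℂ] K),
        RegularDilation.IsMinimalRegularUnitaryDilation hS T ι U →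
        RegularDilation.IsStronglyContinuous τ U) := by
  intro hS
  have hmin : RegularDilation.AlternatingSumsNonneg T →
      RegularDilation.HasMinimalRegularUnitaryDilation hS T := fun h =>
    RegularDilation.hasMinimalRegularUnitaryDilation_of_posSemidef hT.map_zero
      (RegularDilation.posSemidef_dilationKernel hpos hcomm hS hT h)
  have hnec : RegularDilation.HasRegularUnitaryDilation hS T →
      RegularDilation.AlternatingSumsNonneg T := by
    rintro ⟨K, _, _, _, ι, U, h⟩
    exact h.alternatingSumsNonneg hpos hT
  -- The minimal dilation is rebuilt from positivity rather than cut out of the given one.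
  refine ⟨⟨hnec, fun h => ?_⟩, fun h => hmin (hnec h), ?_, ?_⟩
  · obtain ⟨K, i₁, i₂, i₃, ι, U, hU⟩ := hmin h
    exact ⟨K, i₁, i₂, i₃, ι, U, hU.toIsRegularUnitaryDilation⟩
  · intro K₁ _ _ _ K₂ _ _ _ ι₁ U₁ ι₂ U₂ h₁ h₂
    exact h₁.unique h₂
  · intro τ hτ hc K _ _ _ ι U h
    exact h.isStronglyContinuous hT hτ hc
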